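/- Let $\mathcal I$ be a finite table (set of cells) and let $\mathbf A=(a_{ji})$ be the $0$-$1$ matrix whose rows $A_1,\dots,A_J$ ($J\ge 1$) are the indicators of non-empty subsets $S_1,\dots,S_J$ of $\mathcal I$. The cell parameters $\boldsymbol\delta=(\delta(i))_{i\in\mathcal I}$ are either intensities, $\boldsymbol\delta\equiv\boldsymbol\lambda$ with $\lambda(i)>0$, the observed counts $\boldsymbol y\in\mathbb Z_{\ge0}^{\mathcal I}$ being independent Poisson; or probabilities, $\boldsymbol\delta\equiv\boldsymbol p$ with $p(i)>0$ and $\sum_i p(i)=1$, the counts $\boldsymbol y$ being multinomial with $N=\sum_i y(i)\ge 1$. The relational model generated by $\mathbf A$ consists of those $\boldsymbol\delta$ with $\log\boldsymbol\delta=\mathbf A'\boldsymbol\beta$ for some $\boldsymbol\beta\in\mathbb R^J$; the vector $\boldsymbol 1$ may or may not lie in the row space of $\mathbf A$ (overall effect present or absent). An MLE is a maximizer of the likelihood of $\boldsymbol y$ over the model. Put $\boldsymbol q=\boldsymbol y$ for intensities and $\boldsymbol q=\boldsymbol y/N$ for probabilities, and write $\boldsymbol 1\boldsymbol v$ for the sum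 of the components of $\boldsymbol v$. IPF($\gamma$): start from $\delta^{(0)}_\gamma(i)=1$ for all $i$, and for $d=0,1,2,\dots$, with $j\in\{1,\dots,J\}$, $j\equiv d+1 \bmod J$, put $$\delta_\gamma^{(d+1)}(i)=\delta_\gamma^{(d)}(i)\left(\gamma\,\frac{A_j\boldsymbol q}{A_j\boldsymbol\delta_\gamma^{(d)}}\right)^{a_{ji}},\qquad i\in\mathcal I .$$ The procedure halts as soon as $\mathbf A\boldsymbol\delta_\gamma^{(d+1)}=\gamma\mathbf A\boldsymbol q$, with output $\boldsymbol\delta^*_\gamma=\boldsymbol\delta_\gamma^{(d+1)}$; if it never halts, its output is $\boldsymbol\delta^*_\gamma=\lim_{d\to\infty}\boldsymbol\delta^{(d)}_\gamma$ (if this limit exists). G-IPF (in exact arithmetic): for intensities, the output is that of IPF($1$). For probabilities, compute the output $\boldsymbol p^*$ of IPF($1$); if $\boldsymbol 1\boldsymbol p^*=1$, the output is $\boldsymbol p^*$. Otherwise start with $\gamma_L=(\boldsymbol 1\mathbf A\boldsymbol q)^{-1}$ and $\gamma_R=\min_j 1/(A_j\boldsymbol q)$, and repeat: compute $\boldsymbol\delta^*_m$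 for $m=(\gamma_L+\gamma_R)/2$ with IPF($m$); if $\boldsymbol 1\boldsymbol\delta^*_m=1$, halt with output $\boldsymbol\delta^*_m$; if $\boldsymbol 1\boldsymbol\delta^*_m<1$, replace $\gamma_L$ by $m$; else replace $\gamma_R$ by $m$. If this bisection never halts, the output is the limit of the successive vectors $\boldsymbol\delta^*_m$ (if it exists). Theorem. Assume that the maximum likelihood estimate of $\boldsymbol\delta$ under the relational model generated by $\mathbf A$ exists and is unique. Then the output of G-IPF exists (in particular, every call of IPF made by the algorithm has an output, and all the limits that occur exist), it is unique, and it is the maximum likelihood estimate of $\boldsymbol\delta$. This holds for intensities and for probabilities, with or without the overall effect. -/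

import Mathlib

open Filter Topology
open scoped Matrix

noncomputable section

namespace RelationalModel

/-- The two sampling schemes: independent Poisson counts (the cell parameters are intensities)
and multinomial counts (the cell parameters are probabilities). -/
inductive Sampling
  | poisson
  | multinomial

variable {I : Type*} [Fintype I] [DecidableEq I] {J : ℕ}

/-- The model matrix: its rows are the indicators of the generating subsets. -/
def modelMatrix (S : Fin J → Finset I) : Matrix (Fin J) I ℝ :=
  Matrix.of fun j i => if i ∈ S j then 1 else 0

/-- The admissible cell parameters: positive vectors, with total one for probabilities. -/
def parameterSpace (I : Type*) [Fintype I] : Sampling → Set (I → ℝ)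
  | .poisson => {δ | ∀ i, 0 < δ i}
  | .multinomial => {δ | (∀ i, 0 < δ i) ∧ ∑ i, δ i = 1}

/-- The relational model with model matrix `A`: the admissible `δ` with `log δ = A' β`
for some `β`. -/
def relationalModel (s : Sampling) (A : Matrix (Fin J) I ℝ) : Set (I → ℝ) :=
  {δ | δ ∈ parameterSpace I s ∧ ∃ β : Fin J → ℝ, ∀ i, Real.log (δ i) = (Aᵀ *ᵥ β) i}

/-- The likelihood of the cell parameters, i.e. the probability of observing the counts `y`. -/
def likelihood (s : Sampling) (y : I → ℕ) (δ : I → ℝ) : ℝ :=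
  match s with
  | .poisson => ∏ i, (Real.exp (-δ i) * δ i ^ y i / ((y i).factorial : ℝ))
  | .multinomial => (Nat.multinomial Finset.univ y : ℝ) * ∏ i, δ i ^ y i

/-- `δ` is a maximum likelihood estimate of the cell parameters under the relational model
with model matrix `A`. -/
def IsMLE (s : Sampling) (A : Matrix (Fin J) I ℝ) (y : I → ℕ) (δ : I → ℝ) : Prop :=
  δ ∈ relationalModel s A ∧ IsMaxOn (likelihood s y) (relationalModel s A) δ

/-- The vector `q`: observed counts for intensities, observed relative frequencies for
probabilities. -/
def observed (s : Sampling) (y : I → ℕ) (i : I) : ℝ :=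
  match s with
  | .poisson => (y i : ℝ)
  | .multinomial => (y i : ℝ) / ∑ k, (y k : ℝ)

/-- The output of an idealized (exact arithmetic) iterative procedure with successive values
`x 0, x 1, …` and halting test `halt`: the value at the first index that passes the test or,
if no index does, the limit of the values. -/
def IterationOutput (x : ℕ → I → ℝ) (halt : ℕ → Prop) (out : I → ℝ) : Prop :=
  (∃ d, halt d ∧ (∀ e < d, ¬ halt e) ∧ out = x d) ∨
    ((∀ d, ¬ halt d) ∧ Tendsto x atTop (𝓝 out))

/-- The vectors `δ^(d)` of IPF(γ). The `J` subset sums are treated cyclically: with the rows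
numbered from `0`, step `d` treats row `d mod J`. -/
def ipfSeq [NeZero J] (A : Matrix (Fin J) I ℝ) (q : I → ℝ) (γ : ℝ) : ℕ → I → ℝ
  | 0 => fun _ => 1
  | d + 1 => fun i =>
      ipfSeq A q γ d i *
        (γ * ((A *ᵥ q) (Fin.ofNat J d) / (A *ᵥ ipfSeq A q γ d) (Fin.ofNat J d))) ^
          A (Fin.ofNat J d) i

/-- `δ` is the output of IPF(γ); after every update it is tested whether all subset sums
are as desired. -/
def IPFOutput [NeZero J] (A : Matrix (Fin J) I ℝ) (q : I → ℝ) (γ : ℝ) (δ : I → ℝ) : Prop :=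
  IterationOutput (fun d => ipfSeq A q γ (d + 1))
    (fun d => ∀ j, γ * (A *ᵥ q) j = (A *ᵥ ipfSeq A q γ (d + 1)) j) δ

/-- Left end of the initial bisection interval, `(1 A q)⁻¹`. -/
def gammaLeft (A : Matrix (Fin J) I ℝ) (q : I → ℝ) : ℝ := (∑ j, (A *ᵥ q) j)⁻¹

/-- Right end of the initial bisection interval, `min_j 1 / (A_j q)`. -/
def gammaRight [NeZero J] (A : Matrix (Fin J) I ℝ) (q : I → ℝ) : ℝ :=
  Finset.univ.inf' Finset.univ_nonempty fun j => 1 / (A *ᵥ q) j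

/-- A run of the bisection: `γL k`, `γR k` are the current interval ends, `δ k` is the output of
IPF at the midpoint. As long as the total of `δ k` is not one, the midpoint replaces the left end
if the total is less than one and the right end otherwise. (Entries after the first `k` with
total one are irrelevant and unconstrained.) -/
structure IsBisectionRun [NeZero J] (A : Matrix (Fin J) I ℝ) (q : I → ℝ)
    (γL γR : ℕ → ℝ) (δ : ℕ → I → ℝ) : Prop where
  left_zero : γL 0 = gammaLeft A q
  right_zero : γR 0 = gammaRight A q
  ipf : ∀ k, (∀ e < k, ∑ i, δ e i ≠ 1) → IPFOutput A q ((γL k + γR k) / 2) (δ k)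
  left_succ : ∀ k, (∀ e ≤ k, ∑ i, δ e i ≠ 1) →
    γL (k + 1) = if ∑ i, δ k i < 1 then (γL k + γR k) / 2 else γL k
  right_succ : ∀ k, (∀ e ≤ k, ∑ i, δ e i ≠ 1) →
    γR (k + 1) = if ∑ i, δ k i < 1 then γR k else (γL k + γR k) / 2

/-- `δ` is the result of the bisection over the adjustment factor. -/
def BisectionOutput [NeZero J] (A : Matrix (Fin J) I ℝ) (q : I → ℝ) (δ : I → ℝ) : Prop :=
  ∃ (γL γR : ℕ → ℝ) (x : ℕ → I → ℝ), IsBisectionRun A q γL γR x ∧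
    IterationOutput x (fun k => ∑ i, x k i = 1) δ

/-- `δ` is the output of G-IPF. For intensities this is the output of IPF(1). For probabilities
it is the output `p` of IPF(1) if `p` has total one, and otherwise the result of the bisection. -/
def GIPFOutput [NeZero J] (s : Sampling) (A : Matrix (Fin J) I ℝ) (q : I → ℝ) (δ : I → ℝ) :
    Prop :=
  match s with
  | .poisson => IPFOutput A q 1 δ
  | .multinomial => ∃ p, IPFOutput A q 1 p ∧
      ((∑ i, p i = 1 ∧ δ = p) ∨ (∑ i, p i ≠ 1 ∧ BisectionOutput A q δ))

end RelationalModel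

end

/-! For log-linear `δ` and `ε` the vector `log δ - log ε` lies in the row space of `A`, so its inner
product with `v` depends on `A *ᵥ v` only. For `v = δ - ε` that product is a sum of nonnegative
terms, so a log-linear vector is determined by its subset sums (`LogLinear.eq_of_mulVec_eq`).

Fix `γ` and let some positive `p` have the target sums `γ • A *ᵥ q`. Each IPF step lowers the
divergence from `p` by the Poisson divergence between the target and the current value of the
treated sum (`divergence_ipfSeq_sub`). Hence the iterates stay in a compact set of log-linear
vectors, the residuals vanish, and the only cluster point is the log-linear vector with the target
sums (`exists_tendsto_ipfSeq`).

The likelihood equations put the subset sums of the MLE at `A *ᵥ q` for intensities, which settles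
that case, and at `γ' • A *ᵥ q` with some `γ' > 0` for probabilities. Rescaling the MLE then gives a
feasible `p` for every `γ > 0`. The total of the IPF limit is strictly increasing in `γ`
(`LogLinear.sum_lt_sum`), the limit is continuous in `γ` (`LogLinear.tendsto_of_factor`), and the
initial interval contains `γ'`, so bisection finds the MLE. -/

noncomputable section

namespace RelationalModel

/-! ### Scalar divergence inequalities -/

/-- A lower bound for the Poisson divergence of `c` from `b`. -/
theorem sq_sub_le_divergence {b c : ℝ} (hb : 0 < b) (hc : 0 < c) :
    (b - c) ^ 2 ≤ 2 * (b + c) * (b * (Real.log b - Real.log c) + c - b) := by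
  -- With `u = √b`, `v = √c`, the divergence dominates `(u - v) ^ 2` (the Hellinger bound), and `(u
  -- + v) ^ 2 ≤ 2 * (b + c)`.
  obtain ⟨u, hu, rfl⟩ : ∃ u, 0 < u ∧ u ^ 2 = b := ⟨√b, Real.sqrt_pos.2 hb, Real.sq_sqrt hb.le⟩
  obtain ⟨v, hv, rfl⟩ : ∃ v, 0 < v ∧ v ^ 2 = c := ⟨√c, Real.sqrt_pos.2 hc, Real.sq_sqrt hc.le⟩
  have h := Real.log_le_sub_one_of_pos (div_pos hv hu)
  rw [Real.log_div hv.ne' hu.ne'] at h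
  have h1 : u ^ 2 * (Real.log v - Real.log u) ≤ u * v - u ^ 2 := by
    calc _ ≤ u ^ 2 * (v / u - 1) := by gcongr
      _ = _ := by field_simp
  have h2 : (u - v) ^ 2 ≤ u ^ 2 * (Real.log (u ^ 2) - Real.log (v ^ 2)) + v ^ 2 - u ^ 2 := by
    rw [Real.log_pow, Real.log_pow]; push_cast; nlinarith
  calc (u ^ 2 - v ^ 2) ^ 2 = (u + v) ^ 2 * (u - v) ^ 2 := by ring
    _ ≤ (2 * (u ^ 2 + v ^ 2)) * (u - v) ^ 2 := by
      gcongr; nlinarith [sq_nonneg (u - v)]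
    _ ≤ _ := by gcongr

theorem divergence_nonneg {b c : ℝ} (hb : 0 < b) (hc : 0 < c) :
    0 ≤ b * (Real.log b - Real.log c) + c - b := by
  have h := sq_sub_le_divergence hb hc
  by_contra! hn
  nlinarith [sq_nonneg (b - c), mul_pos_of_neg_of_neg hn (show -(b + c) < 0 by linarith)]

/-- The right-hand product is the symmetrized divergence, so the previous bound is added to itself
with the arguments swapped. -/
theorem sq_sub_le_mul_log_sub {x y : ℝ} (hx : 0 < x) (hy : 0 < y) :
    (x - y) ^ 2 ≤ (x + y) * ((x - y) * (Real.log x - Real.log y)) := by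
  nlinarith [sq_sub_le_divergence hx hy, sq_sub_le_divergence hy hx]

theorem mul_log_sub_nonneg {x y : ℝ} (hx : 0 < x) (hy : 0 < y) :
    0 ≤ (x - y) * (Real.log x - Real.log y) := by
  nlinarith [divergence_nonneg hx hy, divergence_nonneg hy hx]

/-! ### Log-linear vectors: uniqueness and compactness -/

section
variable {I : Type*} [Fintype I] {J : ℕ}

/-- Positive vectors whose logarithm lies in the row space of `A`. -/
def LogLinear (A : Matrix (Fin J) I ℝ) (δ : I → ℝ) : Prop :=
  (∀ i, 0 < δ i) ∧ ∃ β : Fin J → ℝ, ∀ i, Real.log (δ i) = (Aᵀ *ᵥ β) i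

theorem sum_mul_transpose_mulVec (A : Matrix (Fin J) I ℝ) (v : I → ℝ) (β : Fin J → ℝ) :
    ∑ i, v i * (Aᵀ *ᵥ β) i = ∑ j, β j * (A *ᵥ v) j := by
  change v ⬝ᵥ (Aᵀ *ᵥ β) = β ⬝ᵥ (A *ᵥ v)
  rw [Matrix.mulVec_transpose, Matrix.dotProduct_mulVec, dotProduct_comm]

theorem LogLinear.exists_sum_mul_log_sub {A : Matrix (Fin J) I ℝ} {δ ε : I → ℝ}
    (hδ : LogLinear A δ) (hε : LogLinear A ε) :
    ∃ β : Fin J → ℝ, ∀ v : I → ℝ,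
      ∑ i, v i * (Real.log (δ i) - Real.log (ε i)) = ∑ j, β j * (A *ᵥ v) j := by
  obtain ⟨-, β, hβ⟩ := hδ
  obtain ⟨-, β', hβ'⟩ := hε
  refine ⟨β - β', fun v => ?_⟩
  rw [← sum_mul_transpose_mulVec]
  exact Finset.sum_congr rfl fun i _ => by rw [hβ, hβ', Matrix.mulVec_sub, Pi.sub_apply]

theorem LogLinear.sq_sub_le {A : Matrix (Fin J) I ℝ} {δ ε : I → ℝ}
    (hδ : LogLinear A δ) (hε : LogLinear A ε) (i : I) :
    (δ i - ε i) ^ 2 ≤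
      (δ i + ε i) * ∑ k, (δ k - ε k) * (Real.log (δ k) - Real.log (ε k)) := by
  refine (sq_sub_le_mul_log_sub (hδ.1 i) (hε.1 i)).trans ?_
  refine mul_le_mul_of_nonneg_left ?_ (add_pos (hδ.1 i) (hε.1 i)).le
  exact Finset.single_le_sum (f := fun k => (δ k - ε k) * (Real.log (δ k) - Real.log (ε k)))
    (fun k _ => mul_log_sub_nonneg (hδ.1 k) (hε.1 k)) (Finset.mem_univ i)

theorem LogLinear.eq_of_mulVec_eq {A : Matrix (Fin J) I ℝ} {δ ε : I → ℝ}
    (hδ : LogLinear A δ) (hε : LogLinear A ε) (h : A *ᵥ δ = A *ᵥ ε) : δ = ε := by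
  obtain ⟨β, hβ⟩ := hδ.exists_sum_mul_log_sub hε
  have h0 := hβ (δ - ε)
  rw [Matrix.mulVec_sub, h, sub_self] at h0
  simp only [Pi.sub_apply, Pi.zero_apply, mul_zero, Finset.sum_const_zero] at h0
  funext i
  have := hδ.sq_sub_le hε i
  rw [h0, mul_zero] at this
  exact sub_eq_zero.1 (pow_eq_zero_iff two_ne_zero |>.1 (le_antisymm this (sq_nonneg _)))

omit [Fintype I] in
theorem isClosed_range_transpose (A : Matrix (Fin J) I ℝ) :
    IsClosed {x : I → ℝ | ∃ β : Fin J → ℝ, x = Aᵀ *ᵥ β} := by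
  have := (LinearMap.range (Matrix.mulVecLin Aᵀ)).closed_of_finiteDimensional
  convert this using 1
  ext x
  simp [eq_comm, Matrix.mulVec_transpose]

omit [Fintype I] in
/-- Log-linear vectors with entries between two positive bounds form a compact set. -/
theorem isCompact_logLinear_box (A : Matrix (Fin J) I ℝ) {l u : I → ℝ} (hl : ∀ i, 0 < l i) :
    IsCompact {δ | LogLinear A δ ∧ δ ∈ Set.Icc l u} := by
  have hK : IsCompact (Set.Icc l u) := isCompact_Icc
  have hc : ContinuousOn (fun δ : I → ℝ => fun i => Real.log (δ i)) (Set.Icc l u) := by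
    refine continuousOn_pi.2 fun i => ContinuousOn.log (by fun_prop) fun δ hδ => ?_
    exact ((hl i).trans_le (hδ.1 i)).ne'
  have := hK.inter_right (hc.preimage_isClosed_of_isClosed hK.isClosed
    (isClosed_range_transpose A))
  convert this using 1
  ext δ
  simp only [LogLinear, Set.mem_ofPred_eq, Set.mem_inter_iff, Set.mem_preimage, funext_iff]
  constructor
  · rintro ⟨⟨_, h⟩, h'⟩; exact ⟨h', h', h⟩
  · rintro ⟨h', _, h⟩; exact ⟨⟨fun i => (hl i).trans_le (h'.1 i), h⟩, h'⟩

/-- The generalized Kullback-Leibler divergence of positive vectors. -/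
def divergence (p δ : I → ℝ) : ℝ :=
  ∑ i, (p i * (Real.log (p i) - Real.log (δ i)) + δ i - p i)

theorem divergence_nonneg_of_pos {p δ : I → ℝ} (hp : ∀ i, 0 < p i) (hδ : ∀ i, 0 < δ i) :
    0 ≤ divergence p δ :=
  Finset.sum_nonneg fun i _ => divergence_nonneg (hp i) (hδ i)

theorem le_divergence {p δ : I → ℝ} (hp : ∀ i, 0 < p i) (hδ : ∀ i, 0 < δ i) (i : I) :
    p i * (Real.log (p i) - Real.log (δ i)) + δ i - p i ≤ divergence p δ :=
  Finset.single_le_sum (f := fun k => p k * (Real.log (p k) - Real.log (δ k)) + δ k - p k)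
    (fun k _ => divergence_nonneg (hp k) (hδ k)) (Finset.mem_univ i)

/-- Sublevel sets of the divergence stay away from zero and infinity. The lower bound comes from
dropping `δ i > 0` in the `i`-th term; the upper one from `(p - δ) ^ 2 ≤ 2 * (p + δ) * K`, which
fails once `δ > 2 * p + 4 * K`. -/
theorem mem_Icc_of_divergence_le {p δ : I → ℝ} {K : ℝ} (hp : ∀ i, 0 < p i) (hδ : ∀ i, 0 < δ i)
    (h : divergence p δ ≤ K) :
    δ ∈ Set.Icc (fun i => Real.exp (Real.log (p i) - (K + p i) / p i))
      (fun i => 2 * p i + 4 * K) := by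
  constructor <;> intro i <;> have hi := (le_divergence hp hδ i).trans h
  · rw [← Real.le_log_iff_exp_le (hδ i)]
    have : Real.log (p i) - Real.log (δ i) ≤ (K + p i) / p i := by
      rw [le_div_iff₀ (hp i)]; nlinarith [hδ i]
    linarith
  · have hK : 0 ≤ K := (divergence_nonneg (hp i) (hδ i)).trans hi
    have h1 := sq_sub_le_divergence (hp i) (hδ i)
    have h2 : (p i - δ i) ^ 2 ≤ 2 * (p i + δ i) * K :=
      h1.trans (mul_le_mul_of_nonneg_left hi (by linarith [hp i, hδ i]))
    by_contra! hn
    simp only at hn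
    nlinarith [hp i, hδ i, mul_nonneg hK (hp i).le, mul_pos (hp i) (hp i),
      mul_nonneg hK (sub_pos.2 hn).le, mul_pos (hp i) (sub_pos.2 hn),
      mul_pos (sub_pos.2 hn) (sub_pos.2 hn)]

end

/-! ### Convergence of IPF for a fixed adjustment factor -/

section
variable {I : Type*} [Fintype I] [DecidableEq I] {J : ℕ}

theorem modelMatrix_mulVec (S : Fin J → Finset I) (v : I → ℝ) (j : Fin J) :
    (modelMatrix S *ᵥ v) j = ∑ i ∈ S j, v i := by
  simp [modelMatrix, Matrix.mulVec, dotProduct, Finset.sum_ite_mem]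

theorem modelMatrix_mulVec_pos {S : Fin J → Finset I} (hS : ∀ j, (S j).Nonempty)
    {v : I → ℝ} (hv : ∀ i, 0 < v i) (j : Fin J) : 0 < (modelMatrix S *ᵥ v) j := by
  rw [modelMatrix_mulVec]
  exact Finset.sum_pos (fun i _ => hv i) (hS j)

omit [Fintype I] in
-- The exponent is 0 or 1, so the multiplicative update is also an affine one.
theorem mul_rpow_modelMatrix (S : Fin J → Finset I) (δ : I → ℝ) (r : ℝ) (j : Fin J) (i : I) :
    δ i * r ^ modelMatrix S j i = δ i + modelMatrix S j i * (δ i * (r - 1)) := by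
  by_cases h : i ∈ S j <;> simp [modelMatrix, h]
  ring

variable [NeZero J] {S : Fin J → Finset I} {q p : I → ℝ} {γ : ℝ}

/-- The positive vector `p` replaces `γ` and `q` as the source of the targets: `q` may have zero
cells, so it cannot serve as the reference point of the divergence. -/
theorem ipfSeq_succ (hp : modelMatrix S *ᵥ p = γ • modelMatrix S *ᵥ q) (d : ℕ) (i : I) :
    ipfSeq (modelMatrix S) q γ (d + 1) i = ipfSeq (modelMatrix S) q γ d i *
      ((modelMatrix S *ᵥ p) (Fin.ofNat J d) /
        (modelMatrix S *ᵥ ipfSeq (modelMatrix S) q γ d) (Fin.ofNat J d)) ^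
          modelMatrix S (Fin.ofNat J d) i := by
  rw [ipfSeq, hp, Pi.smul_apply, smul_eq_mul, mul_div_assoc]

theorem ipfSeq_pos (hS : ∀ j, (S j).Nonempty) (hp : modelMatrix S *ᵥ p = γ • modelMatrix S *ᵥ q)
    (hp0 : ∀ i, 0 < p i) (d : ℕ) (i : I) : 0 < ipfSeq (modelMatrix S) q γ d i := by
  induction d generalizing i with
  | zero => exact one_pos
  | succ d ih =>
    rw [ipfSeq_succ hp]
    exact mul_pos (ih i) (Real.rpow_pos_of_pos (div_pos (modelMatrix_mulVec_pos hS hp0 _)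
      (modelMatrix_mulVec_pos hS ih _)) _)

theorem log_ipfSeq_succ (hS : ∀ j, (S j).Nonempty)
    (hp : modelMatrix S *ᵥ p = γ • modelMatrix S *ᵥ q) (hp0 : ∀ i, 0 < p i) (d : ℕ) (i : I) :
    Real.log (ipfSeq (modelMatrix S) q γ (d + 1) i) =
      Real.log (ipfSeq (modelMatrix S) q γ d i) + modelMatrix S (Fin.ofNat J d) i *
        (Real.log ((modelMatrix S *ᵥ p) (Fin.ofNat J d)) - Real.log
          ((modelMatrix S *ᵥ ipfSeq (modelMatrix S) q γ d) (Fin.ofNat J d))) := by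
  have hb := modelMatrix_mulVec_pos hS hp0 (Fin.ofNat J d)
  have hx := ipfSeq_pos hS hp hp0 d
  have hc := modelMatrix_mulVec_pos hS hx (Fin.ofNat J d)
  rw [ipfSeq_succ hp, Real.log_mul (hx i).ne' (Real.rpow_pos_of_pos (div_pos hb hc) _).ne',
    Real.log_rpow (div_pos hb hc), Real.log_div hb.ne' hc.ne']

theorem logLinear_ipfSeq (hS : ∀ j, (S j).Nonempty)
    (hp : modelMatrix S *ᵥ p = γ • modelMatrix S *ᵥ q) (hp0 : ∀ i, 0 < p i) (d : ℕ) :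
    LogLinear (modelMatrix S) (ipfSeq (modelMatrix S) q γ d) := by
  refine ⟨ipfSeq_pos hS hp hp0 d, ?_⟩
  induction d with
  | zero => exact ⟨0, fun i => by simp [ipfSeq]⟩
  | succ d ih =>
    obtain ⟨β, hβ⟩ := ih
    refine ⟨β + Pi.single (Fin.ofNat J d) (Real.log ((modelMatrix S *ᵥ p) (Fin.ofNat J d)) -
      Real.log ((modelMatrix S *ᵥ ipfSeq (modelMatrix S) q γ d) (Fin.ofNat J d))), fun i => ?_⟩
    rw [log_ipfSeq_succ hS hp hp0, hβ, Matrix.mulVec_add, Pi.add_apply]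
    simp [Matrix.mulVec_single, mul_comm]

/-- The Pythagorean identity for one step of IPF. -/
theorem divergence_ipfSeq_sub (hS : ∀ j, (S j).Nonempty)
    (hp : modelMatrix S *ᵥ p = γ • modelMatrix S *ᵥ q) (hp0 : ∀ i, 0 < p i) (d : ℕ) :
    divergence p (ipfSeq (modelMatrix S) q γ d) - divergence p (ipfSeq (modelMatrix S) q γ (d + 1)) =
      (modelMatrix S *ᵥ p) (Fin.ofNat J d) * (Real.log ((modelMatrix S *ᵥ p) (Fin.ofNat J d)) -
        Real.log ((modelMatrix S *ᵥ ipfSeq (modelMatrix S) q γ d) (Fin.ofNat J d))) +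
      (modelMatrix S *ᵥ ipfSeq (modelMatrix S) q γ d) (Fin.ofNat J d) -
      (modelMatrix S *ᵥ p) (Fin.ofNat J d) := by
  have hx := ipfSeq_pos hS hp hp0 d
  have hc := modelMatrix_mulVec_pos hS hx (Fin.ofNat J d)
  have hl := log_ipfSeq_succ hS hp hp0 d
  have hs := ipfSeq_succ hp d
  simp only [mul_rpow_modelMatrix] at hs
  set x := ipfSeq (modelMatrix S) q γ d
  set b := (modelMatrix S *ᵥ p) (Fin.ofNat J d) with hb
  set c := (modelMatrix S *ᵥ x) (Fin.ofNat J d) with hc'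
  have hb' : b = ∑ i, modelMatrix S (Fin.ofNat J d) i * p i := rfl
  have hc'' : c = ∑ i, modelMatrix S (Fin.ofNat J d) i * x i := rfl
  have : divergence p x - divergence p (ipfSeq (modelMatrix S) q γ (d + 1)) =
      (∑ i, modelMatrix S (Fin.ofNat J d) i * p i) * (Real.log b - Real.log c) +
      (∑ i, modelMatrix S (Fin.ofNat J d) i * x i) * (1 - b / c) := by
    rw [divergence, divergence, ← Finset.sum_sub_distrib, Finset.sum_mul, Finset.sum_mul,
      ← Finset.sum_add_distrib]
    refine Finset.sum_congr rfl fun i _ => ?_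
    rw [hl, hs]
    ring
  rw [this, ← hb', ← hc'']
  field_simp
  ring

theorem antitone_divergence_ipfSeq (hS : ∀ j, (S j).Nonempty)
    (hp : modelMatrix S *ᵥ p = γ • modelMatrix S *ᵥ q) (hp0 : ∀ i, 0 < p i) :
    Antitone fun d => divergence p (ipfSeq (modelMatrix S) q γ d) := by
  refine antitone_nat_of_succ_le fun d => sub_nonneg.1 ?_
  rw [divergence_ipfSeq_sub hS hp hp0]
  exact divergence_nonneg (modelMatrix_mulVec_pos hS hp0 _)
    (modelMatrix_mulVec_pos hS (ipfSeq_pos hS hp hp0 d) _)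

theorem tendsto_divergence_ipfSeq_sub (hS : ∀ j, (S j).Nonempty)
    (hp : modelMatrix S *ᵥ p = γ • modelMatrix S *ᵥ q) (hp0 : ∀ i, 0 < p i) :
    Tendsto (fun d => divergence p (ipfSeq (modelMatrix S) q γ d) -
      divergence p (ipfSeq (modelMatrix S) q γ (d + 1))) atTop (𝓝 0) := by
  have h := tendsto_atTop_ciInf (antitone_divergence_ipfSeq hS hp hp0)
    ⟨0, by rintro _ ⟨d, rfl⟩; exact divergence_nonneg_of_pos hp0 (ipfSeq_pos hS hp hp0 d)⟩
  simpa using h.sub (h.comp (tendsto_add_atTop_nat 1))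

theorem exists_ipfSeq_mem_Icc (hS : ∀ j, (S j).Nonempty)
    (hp : modelMatrix S *ᵥ p = γ • modelMatrix S *ᵥ q) (hp0 : ∀ i, 0 < p i) :
    ∃ l u : I → ℝ, (∀ i, 0 < l i) ∧ ∀ d, ipfSeq (modelMatrix S) q γ d ∈ Set.Icc l u :=
  ⟨_, _, fun _ => Real.exp_pos _, fun d => mem_Icc_of_divergence_le hp0 (ipfSeq_pos hS hp hp0 d)
    (antitone_divergence_ipfSeq hS hp hp0 (Nat.zero_le d))⟩

/-- The deviation of the subset sum treated at step `d` tends to zero. -/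
theorem tendsto_ipfSeq_residual (hS : ∀ j, (S j).Nonempty)
    (hp : modelMatrix S *ᵥ p = γ • modelMatrix S *ᵥ q) (hp0 : ∀ i, 0 < p i) :
    Tendsto (fun d => |(modelMatrix S *ᵥ p) (Fin.ofNat J d) -
      (modelMatrix S *ᵥ ipfSeq (modelMatrix S) q γ d) (Fin.ofNat J d)|) atTop (𝓝 0) := by
  obtain ⟨l, u, -, hu⟩ := exists_ipfSeq_mem_Icc hS hp hp0
  have hle : ∀ v w : I → ℝ, (∀ i, 0 < v i) → v ≤ w → ∀ j, (modelMatrix S *ᵥ v) j ≤ ∑ i, w i := by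
    intro v w hv hvw j
    rw [modelMatrix_mulVec]
    exact (Finset.sum_le_univ_sum_of_nonneg fun i => (hv i).le).trans
      (Finset.sum_le_sum fun i _ => hvw i)
  -- The factor bounds `2 * (b + c)` in `sq_sub_le_divergence` uniformly in `d`.
  have h := (tendsto_divergence_ipfSeq_sub hS hp hp0).const_mul
    (2 * (∑ i, p i + ∑ i, u i))
  rw [mul_zero] at h
  have h2 := squeeze_zero (fun d => sq_nonneg ((modelMatrix S *ᵥ p) (Fin.ofNat J d) -
      (modelMatrix S *ᵥ ipfSeq (modelMatrix S) q γ d) (Fin.ofNat J d))) (fun d => ?_) h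
  · have := h2.sqrt
    simpa only [Real.sqrt_sq_eq_abs, Real.sqrt_zero] using this
  · have hx := ipfSeq_pos hS hp hp0 d
    have hb := modelMatrix_mulVec_pos hS hp0 (Fin.ofNat J d)
    have hc := modelMatrix_mulVec_pos hS hx (Fin.ofNat J d)
    refine (sq_sub_le_divergence hb hc).trans ?_
    rw [divergence_ipfSeq_sub hS hp hp0]
    refine mul_le_mul_of_nonneg_right ?_ (divergence_nonneg hb hc)
    linarith [hle p p hp0 le_rfl (Fin.ofNat J d), hle _ u hx (hu d).2 (Fin.ofNat J d)]

/-- A treated cell absorbs its share, at most 1, of the residual; the other cells do not move. -/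
theorem abs_ipfSeq_succ_sub_le (hS : ∀ j, (S j).Nonempty)
    (hp : modelMatrix S *ᵥ p = γ • modelMatrix S *ᵥ q) (hp0 : ∀ i, 0 < p i) (d : ℕ) (i : I) :
    |ipfSeq (modelMatrix S) q γ (d + 1) i - ipfSeq (modelMatrix S) q γ d i| ≤
      |(modelMatrix S *ᵥ p) (Fin.ofNat J d) -
        (modelMatrix S *ᵥ ipfSeq (modelMatrix S) q γ d) (Fin.ofNat J d)| := by
  have hx := ipfSeq_pos hS hp hp0 d
  have hc := modelMatrix_mulVec_pos hS hx (Fin.ofNat J d)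
  rw [ipfSeq_succ hp, mul_rpow_modelMatrix, add_sub_cancel_left]
  by_cases h : i ∈ S (Fin.ofNat J d)
  · have hle : ipfSeq (modelMatrix S) q γ d i ≤
        (modelMatrix S *ᵥ ipfSeq (modelMatrix S) q γ d) (Fin.ofNat J d) := by
      rw [modelMatrix_mulVec]
      exact Finset.single_le_sum (fun k _ => (hx k).le) h
    set c := (modelMatrix S *ᵥ ipfSeq (modelMatrix S) q γ d) (Fin.ofNat J d)
    have h1 : modelMatrix S (Fin.ofNat J d) i = 1 := if_pos h
    have h2 : ∀ b : ℝ, ipfSeq (modelMatrix S) q γ d i * (b / c - 1) =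
        (ipfSeq (modelMatrix S) q γ d i / c) * (b - c) := fun b => by field_simp
    rw [h1, one_mul, h2, abs_mul, abs_of_pos (div_pos (hx i) hc)]
    exact mul_le_of_le_one_left (abs_nonneg _) ((div_le_one hc).2 hle)
  · have h1 : modelMatrix S (Fin.ofNat J d) i = 0 := if_neg h
    rw [h1, zero_mul, abs_zero]
    exact abs_nonneg _

/-- IPF attains all prescribed subset sums in the limit. -/
theorem tendsto_mulVec_ipfSeq (hS : ∀ j, (S j).Nonempty)
    (hp : modelMatrix S *ᵥ p = γ • modelMatrix S *ᵥ q) (hp0 : ∀ i, 0 < p i) :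
    Tendsto (fun d => modelMatrix S *ᵥ ipfSeq (modelMatrix S) q γ d) atTop
      (𝓝 (modelMatrix S *ᵥ p)) := by
  have hr := tendsto_ipfSeq_residual hS hp hp0
  have hstep : ∀ n i, Tendsto (fun d => ipfSeq (modelMatrix S) q γ (d + n) i -
      ipfSeq (modelMatrix S) q γ d i) atTop (𝓝 0) := by
    intro n i
    induction n with
    | zero => simp
    | succ n ih =>
      have h1 : Tendsto (fun d => ipfSeq (modelMatrix S) q γ (d + 1) i -
          ipfSeq (modelMatrix S) q γ d i) atTop (𝓝 0) :=
        squeeze_zero_norm (fun d => abs_ipfSeq_succ_sub_le hS hp hp0 d i) hr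
      have := (h1.comp (tendsto_add_atTop_nat n)).add ih
      simpa [Function.comp_def, add_assoc] using this
  rw [tendsto_pi_nhds]
  intro j
  have hA : ∀ n, Tendsto (fun d => |(modelMatrix S *ᵥ ipfSeq (modelMatrix S) q γ (d + n)) j -
      (modelMatrix S *ᵥ ipfSeq (modelMatrix S) q γ d) j|) atTop (𝓝 0) := by
    intro n
    simp only [modelMatrix_mulVec, ← Finset.sum_sub_distrib]
    have := (tendsto_finsetSum (S j) fun i _ => hstep n i).abs
    simpa using this
  -- Each row is treated within any `J` consecutive steps, at an offset depending on `d`; summing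
  -- over all offsets avoids tracking it.
  have hB : Tendsto (fun d => ∑ n ∈ Finset.range J,
      (|(modelMatrix S *ᵥ p) (Fin.ofNat J (d + n)) -
        (modelMatrix S *ᵥ ipfSeq (modelMatrix S) q γ (d + n)) (Fin.ofNat J (d + n))| +
      |(modelMatrix S *ᵥ ipfSeq (modelMatrix S) q γ (d + n)) j -
        (modelMatrix S *ᵥ ipfSeq (modelMatrix S) q γ d) j|)) atTop (𝓝 0) := by
    have := tendsto_finsetSum (Finset.range J) fun n _ =>
      (hr.comp (tendsto_add_atTop_nat n)).add (hA n)
    simpa [Function.comp_def] using this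
  rw [tendsto_iff_norm_sub_tendsto_zero]
  refine squeeze_zero (fun d => norm_nonneg _) (fun d => ?_) hB
  obtain ⟨n, hn, hnj⟩ : ∃ n < J, Fin.ofNat J (d + n) = j := by
    have hJ := Nat.pos_of_ne_zero (NeZero.ne J)
    -- This is `j - d` modulo `J`, written without truncated subtraction.
    refine ⟨(j + (J - d % J)) % J, Nat.mod_lt _ hJ, Fin.ext ?_⟩
    have hd := Nat.mod_lt d hJ
    simp only [Fin.ofNat]
    rw [Nat.add_mod, Nat.mod_mod, ← Nat.add_mod]
    have : d + (↑j + (J - d % J)) = j + J * (d / J + 1) := by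
      have := Nat.div_add_mod d J
      rw [mul_add]; omega
    rw [this, Nat.add_mul_mod_self_left, Nat.mod_eq_of_lt j.2]
  refine le_trans ?_ (Finset.single_le_sum (fun n _ => by positivity) (Finset.mem_range.2 hn))
  rw [hnj, Real.norm_eq_abs, ← abs_neg, neg_sub]
  exact abs_sub_le _ _ _

/-- If some positive vector has the prescribed subset sums, then IPF converges to a log-linear
vector with these subset sums. -/
theorem exists_tendsto_ipfSeq (hS : ∀ j, (S j).Nonempty)
    (hp : modelMatrix S *ᵥ p = γ • modelMatrix S *ᵥ q) (hp0 : ∀ i, 0 < p i) :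
    ∃ δ, LogLinear (modelMatrix S) δ ∧ modelMatrix S *ᵥ δ = γ • modelMatrix S *ᵥ q ∧
      Tendsto (ipfSeq (modelMatrix S) q γ) atTop (𝓝 δ) := by
  obtain ⟨l, u, hl, hu⟩ := exists_ipfSeq_mem_Icc hS hp hp0
  have hK := isCompact_logLinear_box (modelMatrix S) (u := u) hl
  have hmem : ∀ d, ipfSeq (modelMatrix S) q γ d ∈
      {δ | LogLinear (modelMatrix S) δ ∧ δ ∈ Set.Icc l u} :=
    fun d => ⟨logLinear_ipfSeq hS hp hp0 d, hu d⟩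
  have hlim := tendsto_mulVec_ipfSeq hS hp hp0
  have hcont : Continuous fun δ : I → ℝ => modelMatrix S *ᵥ δ := by fun_prop
  have key : ∀ δ, MapClusterPt δ atTop (ipfSeq (modelMatrix S) q γ) →
      modelMatrix S *ᵥ δ = modelMatrix S *ᵥ p := by
    intro δ hδ
    have h1 : MapClusterPt (modelMatrix S *ᵥ δ) atTop
        (fun d => modelMatrix S *ᵥ ipfSeq (modelMatrix S) q γ d) :=
      hδ.continuousAt_comp hcont.continuousAt
    by_contra hne
    have : NeBot (𝓝 (modelMatrix S *ᵥ δ) ⊓ 𝓝 (modelMatrix S *ᵥ p)) :=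
      ClusterPt.mono h1 hlim
    exact hne (eq_of_nhds_neBot this)
  obtain ⟨δ, hδK, hδ⟩ := hK.exists_mapClusterPt (f := atTop)
    (u := ipfSeq (modelMatrix S) q γ) (tendsto_principal.2 (Eventually.of_forall hmem))
  refine ⟨δ, hδK.1, (key δ hδ).trans hp, hK.tendsto_nhds_of_unique_mapClusterPt
    (Eventually.of_forall hmem) fun ε hεK hε => ?_⟩
  exact hεK.1.eq_of_mulVec_eq hδK.1 ((key ε hε).trans (key δ hδ).symm)

/-- The output of IPF is the log-linear vector with the prescribed subset sums. -/
theorem ipfOutput_iff (hS : ∀ j, (S j).Nonempty) {δ : I → ℝ} (hδ : LogLinear (modelMatrix S) δ)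
    (h : modelMatrix S *ᵥ δ = γ • modelMatrix S *ᵥ q) (ε : I → ℝ) :
    IPFOutput (modelMatrix S) q γ ε ↔ ε = δ := by
  obtain ⟨δ', hδ', h', hlim⟩ := exists_tendsto_ipfSeq hS h hδ.1
  obtain rfl : δ' = δ := hδ'.eq_of_mulVec_eq hδ (h'.trans h.symm)
  have hlim' := hlim.comp (tendsto_add_atTop_nat 1)
  -- By uniqueness, an iterate that passes the halting test already equals the limit.
  have heq : ∀ d, (∀ j, γ * (modelMatrix S *ᵥ q) j =
      (modelMatrix S *ᵥ ipfSeq (modelMatrix S) q γ (d + 1)) j) →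
      ipfSeq (modelMatrix S) q γ (d + 1) = δ' := fun d hd =>
    (logLinear_ipfSeq hS h hδ.1 _).eq_of_mulVec_eq hδ (by rw [h]; ext j; exact (hd j).symm)
  unfold IPFOutput IterationOutput
  constructor
  · rintro (⟨d, hd, -, rfl⟩ | ⟨-, ht⟩)
    · exact heq d hd
    · exact tendsto_nhds_unique ht hlim'
  · rintro rfl
    by_cases hex : ∃ d, ∀ j, γ * (modelMatrix S *ᵥ q) j =
      (modelMatrix S *ᵥ ipfSeq (modelMatrix S) q γ (d + 1)) j
    · classical
      exact Or.inl ⟨Nat.find hex, Nat.find_spec hex, fun e he => Nat.find_min hex he,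
        (heq _ (Nat.find_spec hex)).symm⟩
    · exact Or.inr ⟨not_exists.1 hex, hlim'⟩

end

/-! ### Likelihood equations -/

section
variable {I : Type*} [Fintype I] {J : ℕ}

/-- The cell parameters with coefficient vector `β`. -/
def cellParameters (A : Matrix (Fin J) I ℝ) (β : Fin J → ℝ) (i : I) : ℝ :=
  Real.exp ((Aᵀ *ᵥ β) i)

/-- The logarithm of one cell parameter as a linear form in the coefficients. -/
def logCell (A : Matrix (Fin J) I ℝ) (i : I) : (Fin J → ℝ) →L[ℝ] ℝ :=
  (ContinuousLinearMap.proj i).comp (Matrix.mulVecLin Aᵀ).toContinuousLinearMap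

/-- Reads the subset sums off a derivative evaluated in the coordinate directions. -/
theorem sum_smul_logCell_apply_single (A : Matrix (Fin J) I ℝ) (v : I → ℝ) (j : Fin J) :
    (∑ i, v i • logCell A i) (Pi.single j 1) = (A *ᵥ v) j := by
  simp [logCell, Matrix.mulVec, dotProduct, mul_comm]

theorem hasStrictFDerivAt_sum_cellParameters (A : Matrix (Fin J) I ℝ) (β : Fin J → ℝ) :
    HasStrictFDerivAt (fun β => ∑ i, cellParameters A β i)
      (∑ i, cellParameters A β i • logCell A i) β :=
  HasStrictFDerivAt.fun_sum fun i _ => (logCell A i).hasStrictFDerivAt.exp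

omit [Fintype I] in
theorem LogLinear.eq_cellParameters {A : Matrix (Fin J) I ℝ} {δ : I → ℝ} {β : Fin J → ℝ}
    (h0 : ∀ i, 0 < δ i) (h : ∀ i, Real.log (δ i) = (Aᵀ *ᵥ β) i) : δ = cellParameters A β := by
  funext i
  rw [cellParameters, ← h, Real.exp_log (h0 i)]

/-- The log of the likelihood kernel is linear in the coefficients. -/
theorem prod_cellParameters_pow (A : Matrix (Fin J) I ℝ) (y : I → ℕ) (β : Fin J → ℝ) :
    ∏ i, cellParameters A β i ^ y i = Real.exp ((∑ i, (y i : ℝ) • logCell A i) β) := by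
  simp only [sum_apply, Real.exp_sum, smul_apply,
    smul_eq_mul, Real.exp_nat_mul]
  rfl

/-- The likelihood equations for Poisson sampling. -/
theorem IsMLE.mulVec_eq_of_poisson {A : Matrix (Fin J) I ℝ} {y : I → ℕ} {δ : I → ℝ}
    (h : IsMLE .poisson A y δ) :
    A *ᵥ δ = A *ᵥ fun i => (y i : ℝ) := by
  obtain ⟨⟨h0, β, hβ⟩, hmax⟩ := h
  obtain rfl := LogLinear.eq_cellParameters h0 hβ
  have hlik : ∀ β', likelihood .poisson y (cellParameters A β') =
      (∏ i, ((y i).factorial : ℝ))⁻¹ * Real.exp ((∑ i, (y i : ℝ) • logCell A i) β' -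
        ∑ i, cellParameters A β' i) := by
    intro β'
    rw [Real.exp_sub, ← prod_cellParameters_pow]
    have he : ∏ i, Real.exp (-cellParameters A β' i) =
        (Real.exp (∑ i, cellParameters A β' i))⁻¹ := by
      rw [← Real.exp_sum, Finset.sum_neg_distrib, Real.exp_neg]
    simp only [likelihood, Finset.prod_div_distrib, Finset.prod_mul_distrib, he]
    ring
  have hC : 0 < (∏ i, ((y i).factorial : ℝ))⁻¹ := by positivity
  have hloc : IsLocalMax (fun β' => (∑ i, (y i : ℝ) • logCell A i) β' -
      ∑ i, cellParameters A β' i) β := by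
    refine Eventually.of_forall fun β' => ?_
    have := hmax (show cellParameters A β' ∈ relationalModel .poisson A from
      ⟨fun i => Real.exp_pos _, β', fun i => Real.log_exp _⟩)
    simp only [Set.mem_ofPred_eq, hlik] at this
    exact Real.exp_le_exp.1 (le_of_mul_le_mul_left this hC)
  have := hloc.hasFDerivAt_eq_zero
    ((∑ i, (y i : ℝ) • logCell A i).hasStrictFDerivAt.fun_sub
      (hasStrictFDerivAt_sum_cellParameters A β)).hasFDerivAt
  funext j
  have hj := DFunLike.congr_fun this (Pi.single j 1)
  rw [sub_apply, sum_smul_logCell_apply_single,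
    sum_smul_logCell_apply_single] at hj
  exact (sub_eq_zero.1 hj).symm

/-- The likelihood equations for multinomial sampling, with a Lagrange multiplier. -/
theorem IsMLE.exists_multiplier {A : Matrix (Fin J) I ℝ} {y : I → ℕ} {δ : I → ℝ}
    (h : IsMLE .multinomial A y δ) :
    ∃ a b : ℝ, (a, b) ≠ 0 ∧ ∀ j, a * (A *ᵥ δ) j + b * (A *ᵥ fun i => (y i : ℝ)) j = 0 := by
  obtain ⟨⟨⟨h0, h1⟩, β, hβ⟩, hmax⟩ := h
  obtain rfl := LogLinear.eq_cellParameters h0 hβ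
  have hC : (0 : ℝ) < Nat.multinomial Finset.univ y := by
    exact_mod_cast Nat.multinomial_pos _ _
  have hloc : IsLocalExtrOn (∑ i, (y i : ℝ) • logCell A i : (Fin J → ℝ) →L[ℝ] ℝ)
      {β' | ∑ i, cellParameters A β' i = ∑ i, cellParameters A β i} β := by
    refine Or.inr (IsMaxOn.localize fun β' hβ' => ?_)
    have := hmax (show cellParameters A β' ∈ relationalModel .multinomial A from
      ⟨⟨fun i => Real.exp_pos _, hβ'.trans h1⟩, β', fun i => Real.log_exp _⟩)
    simp only [Set.mem_ofPred_eq, likelihood, prod_cellParameters_pow] at this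
    exact Real.exp_le_exp.1 (le_of_mul_le_mul_left this hC)
  obtain ⟨a, b, hab, hL⟩ := hloc.exists_multipliers_of_hasStrictFDerivAt_1d
    (hasStrictFDerivAt_sum_cellParameters A β)
    (∑ i, (y i : ℝ) • logCell A i : (Fin J → ℝ) →L[ℝ] ℝ).hasStrictFDerivAt
  refine ⟨a, b, hab, fun j => ?_⟩
  have hj := DFunLike.congr_fun hL (Pi.single j 1)
  rw [add_apply, smul_apply,
    smul_apply, sum_smul_logCell_apply_single,
    sum_smul_logCell_apply_single] at hj
  exact hj

variable [DecidableEq I]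

/-- If a model for probabilities is not empty, then the generating subsets cover the table. -/
theorem exists_mem_of_mem_relationalModel [NeZero J] {S : Fin J → Finset I}
    (hS : ∀ j, (S j).Nonempty) {δ : I → ℝ}
    (h : δ ∈ relationalModel .multinomial (modelMatrix S)) (i : I) : ∃ j, i ∈ S j := by
  obtain ⟨⟨h0, h1⟩, β, hβ⟩ := h
  by_contra! hi
  -- An uncovered cell has log-parameter 0, hence uses up the whole total, while `S 0` supplies
  -- another positive cell.
  have hi1 : δ i = 1 := by
    have : Real.log (δ i) = 0 := by
      rw [hβ]
      simp [Matrix.mulVec, dotProduct, modelMatrix, hi]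
    exact Real.eq_one_of_pos_of_log_eq_zero (h0 i) this
  obtain ⟨k, hk⟩ := hS 0
  have hki : k ≠ i := fun e => hi 0 (e ▸ hk)
  have := Finset.add_le_sum (s := Finset.univ) (f := δ) (fun i _ => (h0 i).le)
    (Finset.mem_univ i) (Finset.mem_univ k) hki.symm
  linarith [h0 k]

theorem sum_le_sum_modelMatrix_mulVec {S : Fin J → Finset I} (hcov : ∀ i, ∃ j, i ∈ S j)
    {v : I → ℝ} (hv : ∀ i, 0 ≤ v i) : ∑ i, v i ≤ ∑ j, (modelMatrix S *ᵥ v) j := by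
  simp only [Matrix.mulVec, dotProduct]
  rw [Finset.sum_comm]
  refine Finset.sum_le_sum fun i _ => ?_
  obtain ⟨j, hj⟩ := hcov i
  have h1 : modelMatrix S j i * v i = v i := by simp [modelMatrix, hj]
  refine h1.ge.trans (Finset.single_le_sum (f := fun j => modelMatrix S j i * v i)
    (fun k _ => mul_nonneg ?_ (hv i)) (Finset.mem_univ j))
  by_cases h : i ∈ S k <;> simp [modelMatrix, h]

/-- The likelihood equations for multinomial sampling: the subset sums of the estimate are
proportional to the observed ones. -/
theorem IsMLE.exists_mulVec_eq_smul [NeZero J] {S : Fin J → Finset I} (hS : ∀ j, (S j).Nonempty)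
    {y : I → ℕ} (hy : 0 < ∑ i, y i) {δ : I → ℝ}
    (h : IsMLE .multinomial (modelMatrix S) y δ) :
    ∃ γ : ℝ, 0 < γ ∧
      modelMatrix S *ᵥ δ = γ • modelMatrix S *ᵥ observed .multinomial y := by
  have hcov := exists_mem_of_mem_relationalModel hS h.1
  obtain ⟨a, b, hab, hL⟩ := h.exists_multiplier
  have hδ := modelMatrix_mulVec_pos hS h.1.1.1
  have hN : (0 : ℝ) < ∑ k, (y k : ℝ) := by exact_mod_cast hy
  have hobs : (fun i => (y i : ℝ)) = (∑ k, (y k : ℝ)) • observed .multinomial y := by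
    funext i
    simp only [observed, Pi.smul_apply, smul_eq_mul]
    field_simp
  have hsum := sum_le_sum_modelMatrix_mulVec hcov (v := fun i => (y i : ℝ)) fun i => by positivity
  have hb : b ≠ 0 := by
    rintro rfl
    have := hL 0
    rw [zero_mul, add_zero] at this
    exact hab (by rw [(mul_eq_zero.1 this).resolve_right (hδ 0).ne']; rfl)
  -- Otherwise all observed subset sums vanish, although the subsets cover the table and the sample
  -- is not empty.
  have ha : a ≠ 0 := by
    rintro rfl
    have : ∀ j, (modelMatrix S *ᵥ fun i => (y i : ℝ)) j = 0 := fun j => by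
      simpa [hb] using hL j
    simp only [this, Finset.sum_const_zero] at hsum
    linarith
  have hδy : ∀ j, (modelMatrix S *ᵥ δ) j = -(b / a) * (modelMatrix S *ᵥ fun i => (y i : ℝ)) j := by
    intro j
    have := hL j
    field_simp
    linarith
  refine ⟨-(b / a) * ∑ k, (y k : ℝ), mul_pos ?_ hN, ?_⟩
  · have h0 := hδ 0
    rw [hδy] at h0
    refine pos_of_mul_pos_left h0 ?_
    rw [modelMatrix_mulVec]
    positivity
  · funext j
    have hAy : modelMatrix S *ᵥ (fun i => (y i : ℝ)) =
        (∑ k, (y k : ℝ)) • modelMatrix S *ᵥ observed .multinomial y := by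
      rw [← Matrix.mulVec_smul, ← hobs]
    rw [hδy, hAy, Pi.smul_apply, Pi.smul_apply, smul_eq_mul, smul_eq_mul, mul_assoc]

end

/-! ### Dependence on the adjustment factor -/

section
variable {I : Type*} [Fintype I] {J : ℕ} {A : Matrix (Fin J) I ℝ} {q : I → ℝ}

/-- Comparison of two log-linear vectors whose subset sums are multiples of those of `q`. -/
theorem LogLinear.exists_slope {δ ε : I → ℝ} {γ γ' : ℝ}
    (hδ : LogLinear A δ) (hε : LogLinear A ε) (h : A *ᵥ δ = γ • A *ᵥ q)
    (h' : A *ᵥ ε = γ' • A *ᵥ q) :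
    ∃ t : ℝ, γ' * t ≤ ∑ i, δ i - ∑ i, ε i ∧ ∑ i, δ i - ∑ i, ε i ≤ γ * t ∧
      ∑ i, (δ i - ε i) * (Real.log (δ i) - Real.log (ε i)) = (γ - γ') * t := by
  obtain ⟨β, hβ⟩ := hδ.exists_sum_mul_log_sub hε
  have key : ∀ (v : I → ℝ) (r : ℝ), A *ᵥ v = r • A *ᵥ q →
      ∑ i, v i * (Real.log (δ i) - Real.log (ε i)) = r * ∑ j, β j * (A *ᵥ q) j := by
    intro v r hv
    rw [hβ, hv, Finset.mul_sum]
    exact Finset.sum_congr rfl fun j _ => by rw [Pi.smul_apply, smul_eq_mul]; ring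
  -- The two bounds are nonnegativity of the divergence in either direction.
  refine ⟨∑ j, β j * (A *ᵥ q) j, ?_, ?_, ?_⟩
  · rw [← key ε γ' h', ← Finset.sum_sub_distrib]
    exact Finset.sum_le_sum fun i _ => by linarith [divergence_nonneg (hε.1 i) (hδ.1 i)]
  · rw [← key δ γ h, ← Finset.sum_sub_distrib]
    exact Finset.sum_le_sum fun i _ => by linarith [divergence_nonneg (hδ.1 i) (hε.1 i)]
  · rw [sub_mul, ← key δ γ h, ← key ε γ' h', ← Finset.sum_sub_distrib]
    exact Finset.sum_congr rfl fun i _ => sub_mul _ _ _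

/-- The total is strictly increasing in the adjustment factor. -/
theorem LogLinear.sum_lt_sum {δ ε : I → ℝ} {γ γ' : ℝ} (hq : A *ᵥ q ≠ 0)
    (hδ : LogLinear A δ) (hε : LogLinear A ε) (h : A *ᵥ δ = γ • A *ᵥ q)
    (h' : A *ᵥ ε = γ' • A *ᵥ q) (hγ' : 0 < γ') (hlt : γ' < γ) : ∑ i, ε i < ∑ i, δ i := by
  obtain ⟨t, h1, -, h3⟩ := hδ.exists_slope hε h h'
  have hpos : 0 ≤ ∑ i, (δ i - ε i) * (Real.log (δ i) - Real.log (ε i)) :=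
    Finset.sum_nonneg fun i _ => mul_log_sub_nonneg (hδ.1 i) (hε.1 i)
  have ht : 0 < t := by
    refine lt_of_le_of_ne (nonneg_of_mul_nonneg_right (h3 ▸ hpos) (sub_pos.2 hlt)) ?_
    rintro rfl
    have heq : δ = ε := by
      funext i
      have := hδ.sq_sub_le hε i
      rw [h3, mul_zero, mul_zero] at this
      exact sub_eq_zero.1 (pow_eq_zero_iff two_ne_zero |>.1 (le_antisymm this (sq_nonneg _)))
    have h0 : (γ - γ') • A *ᵥ q = 0 := by rw [sub_smul, ← h, ← h', heq, sub_self]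
    exact (smul_eq_zero.1 h0).elim (sub_pos.2 hlt).ne' hq
  linarith [mul_pos hγ' ht]

theorem LogLinear.eq_of_sum_eq {δ ε : I → ℝ} {γ γ' : ℝ} (hq : A *ᵥ q ≠ 0)
    (hδ : LogLinear A δ) (hε : LogLinear A ε) (h : A *ᵥ δ = γ • A *ᵥ q)
    (h' : A *ᵥ ε = γ' • A *ᵥ q) (hγ : 0 < γ) (hγ' : 0 < γ') (hsum : ∑ i, δ i = ∑ i, ε i) :
    δ = ε := by
  rcases lt_trichotomy γ γ' with hlt | rfl | hlt
  · exact absurd hsum (hε.sum_lt_sum hq hδ h' h hγ hlt).ne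
  · exact hδ.eq_of_mulVec_eq hε (h.trans h'.symm)
  · exact absurd hsum (hδ.sum_lt_sum hq hε h h' hγ' hlt).ne'

variable [DecidableEq I] {S : Fin J → Finset I}

/-- A modulus of continuity: the right side involves `δ` only through `γ` and vanishes as `γ → γ'`.
Covering gives `∑ δ ≤ γ * ∑ A_j q`, and `exists_slope` then bounds the slope `t` on both sides. -/
theorem LogLinear.sq_sub_le_of_factor {δ ε : I → ℝ} {γ γ' : ℝ} (hcov : ∀ i, ∃ j, i ∈ S j)
    (hδ : LogLinear (modelMatrix S) δ) (hε : LogLinear (modelMatrix S) ε)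
    (h : modelMatrix S *ᵥ δ = γ • modelMatrix S *ᵥ q)
    (h' : modelMatrix S *ᵥ ε = γ' • modelMatrix S *ᵥ q) (hγ : 0 < γ) (hγ' : 0 < γ') (i : I) :
    (δ i - ε i) ^ 2 ≤ (γ * ∑ j, (modelMatrix S *ᵥ q) j + ∑ i, ε i) *
      (|γ - γ'| * (γ * (γ * ∑ j, (modelMatrix S *ᵥ q) j) + γ' * ∑ i, ε i) / (γ * γ')) := by
  obtain ⟨t, h1, h2, h3⟩ := hδ.exists_slope hε h h'
  have hF : ∑ i, δ i ≤ γ * ∑ j, (modelMatrix S *ᵥ q) j := by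
    have := sum_le_sum_modelMatrix_mulVec hcov fun i => (hδ.1 i).le
    simpa [h, Finset.mul_sum] using this
  have hF0 : 0 ≤ ∑ i, δ i := Finset.sum_nonneg fun i _ => (hδ.1 i).le
  have hE0 : 0 ≤ ∑ i, ε i := Finset.sum_nonneg fun i _ => (hε.1 i).le
  have hδi : δ i ≤ ∑ i, δ i := Finset.single_le_sum (fun k _ => (hδ.1 k).le) (Finset.mem_univ i)
  have hεi : ε i ≤ ∑ i, ε i := Finset.single_le_sum (fun k _ => (hε.1 k).le) (Finset.mem_univ i)
  refine (hδ.sq_sub_le hε i).trans ?_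
  have hpos : 0 ≤ ∑ i, (δ i - ε i) * (Real.log (δ i) - Real.log (ε i)) :=
    Finset.sum_nonneg fun i _ => mul_log_sub_nonneg (hδ.1 i) (hε.1 i)
  refine mul_le_mul (by linarith) ?_ hpos (by linarith)
  rw [h3, le_div_iff₀ (mul_pos hγ hγ')]
  set C := γ * ∑ j, (modelMatrix S *ᵥ q) j
  rcases le_total γ' γ with hle | hle
  · rw [abs_of_nonneg (sub_nonneg.2 hle), mul_assoc]
    refine mul_le_mul_of_nonneg_left ?_ (sub_nonneg.2 hle)
    have : γ * (γ' * t) ≤ γ * C := mul_le_mul_of_nonneg_left (by linarith) hγ.le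
    nlinarith
  · rw [abs_of_nonpos (sub_nonpos.2 hle), neg_mul, ← mul_neg, mul_assoc, mul_neg, ← neg_mul]
    rw [show (γ - γ') * (t * (γ * γ')) = -(γ - γ') * (-t * (γ * γ')) by ring]
    refine mul_le_mul_of_nonneg_left ?_ (by linarith)
    have : γ' * (γ * -t) ≤ γ' * ∑ i, ε i := mul_le_mul_of_nonneg_left (by linarith) hγ'.le
    nlinarith

/-- The log-linear vector depends continuously on the adjustment factor. -/
theorem LogLinear.tendsto_of_factor {x : ℕ → I → ℝ} {ε : I → ℝ} {γ : ℕ → ℝ} {γ' : ℝ}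
    (hcov : ∀ i, ∃ j, i ∈ S j) (hx : ∀ k, LogLinear (modelMatrix S) (x k))
    (hε : LogLinear (modelMatrix S) ε)
    (h : ∀ k, modelMatrix S *ᵥ x k = γ k • modelMatrix S *ᵥ q)
    (h' : modelMatrix S *ᵥ ε = γ' • modelMatrix S *ᵥ q) (hγ : ∀ k, 0 < γ k) (hγ' : 0 < γ')
    (hlim : Tendsto γ atTop (𝓝 γ')) : Tendsto x atTop (𝓝 ε) := by
  refine tendsto_pi_nhds.2 fun i => tendsto_iff_norm_sub_tendsto_zero.2 ?_
  have hc : ContinuousAt (fun g : ℝ => (g * ∑ j, (modelMatrix S *ᵥ q) j + ∑ i, ε i) *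
      (|g - γ'| * (g * (g * ∑ j, (modelMatrix S *ᵥ q) j) + γ' * ∑ i, ε i) / (g * γ'))) γ' := by
    have : γ' * γ' ≠ 0 := (mul_pos hγ' hγ').ne'
    fun_prop (disch := assumption)
  have h0 := hc.tendsto.comp hlim
  simp only [sub_self, abs_zero, zero_mul, zero_div, mul_zero] at h0
  have h2 := (squeeze_zero (fun k => sq_nonneg (x k i - ε i)) (fun k =>
    (hx k).sq_sub_le_of_factor hcov hε (h k) h' (hγ k) hγ' i) h0).sqrt
  simpa only [Real.sqrt_sq_eq_abs, Real.sqrt_zero, Real.norm_eq_abs] using h2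

/-! ### The bisection -/

variable [NeZero J]

-- The subset sums together count every cell at least once, so they add up to at least the total 1.
omit [NeZero J] in
theorem gammaLeft_le {ε : I → ℝ} {γ : ℝ} (hcov : ∀ i, ∃ j, i ∈ S j)
    (hε : ∀ i, 0 < ε i) (hsum : ∑ i, ε i = 1)
    (h : modelMatrix S *ᵥ ε = γ • modelMatrix S *ᵥ q) (hγ : 0 < γ) :
    0 < gammaLeft (modelMatrix S) q ∧ gammaLeft (modelMatrix S) q ≤ γ := by
  have h1 : 1 ≤ γ * ∑ j, (modelMatrix S *ᵥ q) j := by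
    have := sum_le_sum_modelMatrix_mulVec hcov fun i => (hε i).le
    simpa [h, Finset.mul_sum, hsum] using this
  have hQ : 0 < ∑ j, (modelMatrix S *ᵥ q) j := by
    by_contra! hn
    nlinarith
  exact ⟨inv_pos.2 hQ, (inv_le_iff_one_le_mul₀ hQ).2 h1⟩

/-- No subset sum exceeds the total 1. -/
theorem le_gammaRight {ε : I → ℝ} {γ : ℝ} (hS : ∀ j, (S j).Nonempty)
    (hε : ∀ i, 0 < ε i) (hsum : ∑ i, ε i = 1)
    (h : modelMatrix S *ᵥ ε = γ • modelMatrix S *ᵥ q) (hγ : 0 < γ) :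
    γ ≤ gammaRight (modelMatrix S) q := by
  refine Finset.le_inf' _ _ fun j _ => ?_
  have hj : (modelMatrix S *ᵥ ε) j = γ * (modelMatrix S *ᵥ q) j := by rw [h]; rfl
  have h0 := modelMatrix_mulVec_pos hS hε j
  have h1 : (modelMatrix S *ᵥ ε) j ≤ 1 := by
    rw [modelMatrix_mulVec, ← hsum]
    exact Finset.sum_le_univ_sum_of_nonneg fun i => (hε i).le
  rw [hj] at h0 h1
  rwa [le_div_iff₀ (pos_of_mul_pos_right h0 hγ.le)]

/-- The log-linear vector for a given adjustment factor exists as soon as it does for one. -/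
theorem LogLinear.exists_of_factor (hS : ∀ j, (S j).Nonempty) {ε : I → ℝ} {γ' : ℝ}
    (hε : LogLinear (modelMatrix S) ε)
    (h' : modelMatrix S *ᵥ ε = γ' • modelMatrix S *ᵥ q) (hγ' : 0 < γ') {γ : ℝ} (hγ : 0 < γ) :
    ∃ δ, LogLinear (modelMatrix S) δ ∧ modelMatrix S *ᵥ δ = γ • modelMatrix S *ᵥ q := by
  -- The rescaled vector need not be log-linear; it only has to be a positive vector with the target
  -- sums.
  have hp : modelMatrix S *ᵥ ((γ / γ') • ε) = γ • modelMatrix S *ᵥ q := by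
    rw [Matrix.mulVec_smul, h', smul_smul, div_mul_cancel₀ _ hγ'.ne']
  obtain ⟨δ, hδ, h, -⟩ := exists_tendsto_ipfSeq hS hp
    fun i => mul_pos (div_pos hγ hγ') (hε.1 i)
  exact ⟨δ, hδ, h⟩

/-- The invariants of the bisection. -/
theorem IsBisectionRun.invariant (hS : ∀ j, (S j).Nonempty) (hcov : ∀ i, ∃ j, i ∈ S j)
    {ε : I → ℝ} {γ' : ℝ} (hε : LogLinear (modelMatrix S) ε) (hsum : ∑ i, ε i = 1)
    (h' : modelMatrix S *ᵥ ε = γ' • modelMatrix S *ᵥ q) (hγ' : 0 < γ')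
    (hq : modelMatrix S *ᵥ q ≠ 0)
    {γL γR : ℕ → ℝ} {x : ℕ → I → ℝ} (hrun : IsBisectionRun (modelMatrix S) q γL γR x) (k : ℕ)
    (hk : ∀ e < k, ∑ i, x e i ≠ 1) :
    (0 < γL k ∧ γL k ≤ γ' ∧ γ' ≤ γR k ∧ γR k - γL k = (γR 0 - γL 0) / 2 ^ k) ∧
      LogLinear (modelMatrix S) (x k) ∧
      modelMatrix S *ᵥ x k = ((γL k + γR k) / 2) • modelMatrix S *ᵥ q := by
  have hout : ∀ k, (∀ e < k, ∑ i, x e i ≠ 1) → 0 < γL k → γL k ≤ γ' → γ' ≤ γR k →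
      LogLinear (modelMatrix S) (x k) ∧
      modelMatrix S *ᵥ x k = ((γL k + γR k) / 2) • modelMatrix S *ᵥ q := by
    intro k hk h1 h2 h3
    obtain ⟨δ, hδ, h⟩ := hε.exists_of_factor hS h' hγ'
      (show 0 < (γL k + γR k) / 2 by linarith)
    rw [(ipfOutput_iff hS hδ h _).1 (hrun.ipf k hk)]
    exact ⟨hδ, h⟩
  induction k with
  | zero =>
    have hL := gammaLeft_le hcov hε.1 hsum h' hγ'
    have hR := le_gammaRight hS hε.1 hsum h' hγ'
    rw [← hrun.left_zero] at hL
    rw [← hrun.right_zero] at hR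
    exact ⟨⟨hL.1, hL.2, hR, by simp⟩, hout 0 hk hL.1 hL.2 hR⟩
  | succ k ih =>
    obtain ⟨⟨h1, h2, h3, h4⟩, hx, hAx⟩ := ih fun e he => hk e (he.trans k.lt_succ_self)
    have hke : ∀ e ≤ k, ∑ i, x e i ≠ 1 := fun e he => hk e (Nat.lt_succ_of_le he)
    have hLs := hrun.left_succ k hke
    have hRs := hrun.right_succ k hke
    have hm : 0 < (γL k + γR k) / 2 := by linarith
    have inv : 0 < γL (k + 1) ∧ γL (k + 1) ≤ γ' ∧ γ' ≤ γR (k + 1) ∧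
        γR (k + 1) - γL (k + 1) = (γR 0 - γL 0) / 2 ^ (k + 1) := by
      rw [hLs, hRs, pow_succ, ← div_div, ← h4]
      by_cases hlt : ∑ i, x k i < 1
      · rw [if_pos hlt, if_pos hlt]
        refine ⟨hm, ?_, h3, by ring⟩
        -- A midpoint beyond `γ'` would have total above 1 by strict monotonicity.
        by_contra! hn
        exact lt_asymm hlt (hsum ▸ hx.sum_lt_sum hq hε hAx h' hγ' hn)
      · rw [if_neg hlt, if_neg hlt]
        refine ⟨h1, h2, ?_, by ring⟩
        by_contra! hn
        exact hlt (hsum ▸ hε.sum_lt_sum hq hx h' hAx hm hn)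
    exact ⟨inv, hout (k + 1) hk inv.1 inv.2.1 inv.2.2.1⟩

/-- Every run of the bisection has the log-linear vector with total one as its output. -/
theorem IsBisectionRun.iterationOutput_iff (hS : ∀ j, (S j).Nonempty)
    (hcov : ∀ i, ∃ j, i ∈ S j)
    {ε : I → ℝ} {γ' : ℝ} (hε : LogLinear (modelMatrix S) ε) (hsum : ∑ i, ε i = 1)
    (h' : modelMatrix S *ᵥ ε = γ' • modelMatrix S *ᵥ q) (hγ' : 0 < γ')
    (hq : modelMatrix S *ᵥ q ≠ 0)
    {γL γR : ℕ → ℝ} {x : ℕ → I → ℝ} (hrun : IsBisectionRun (modelMatrix S) q γL γR x)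
    (δ : I → ℝ) : IterationOutput x (fun k => ∑ i, x k i = 1) δ ↔ δ = ε := by
  have hinv := hrun.invariant hS hcov hε hsum h' hγ' hq
  have hhalt : ∀ k, (∀ e < k, ∑ i, x e i ≠ 1) → ∑ i, x k i = 1 → x k = ε := by
    intro k hk h1
    obtain ⟨⟨h2, h3, h4, -⟩, hx, hAx⟩ := hinv k hk
    exact hx.eq_of_sum_eq hq hε hAx h' (by linarith) hγ' (h1.trans hsum.symm)
  have hlim : (∀ k, ∑ i, x k i ≠ 1) → Tendsto x atTop (𝓝 ε) := by
    intro hne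
    have hi := fun k => hinv k fun e _ => hne e
    have hw : Tendsto (fun k : ℕ => (γR 0 - γL 0) / 2 ^ k) atTop (𝓝 0) := by
      have := (tendsto_pow_atTop_nhds_zero_of_lt_one (r := (1 / 2 : ℝ)) (by norm_num)
        (by norm_num)).const_mul (γR 0 - γL 0)
      simpa [div_eq_mul_inv] using this
    refine LogLinear.tendsto_of_factor hcov (fun k => (hi k).2.1) hε (fun k => (hi k).2.2) h'
      (fun k => by linarith [(hi k).1.1, (hi k).1.2.1, (hi k).1.2.2.1]) hγ' ?_
    refine tendsto_iff_norm_sub_tendsto_zero.2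
      (squeeze_zero (fun k => norm_nonneg _) (fun k => ?_) hw)
    obtain ⟨-, h2, h3, h4⟩ := (hi k).1
    rw [← h4, Real.norm_eq_abs, abs_le]
    constructor <;> linarith
  unfold IterationOutput
  constructor
  · rintro (⟨d, hd, hmin, rfl⟩ | ⟨hne, ht⟩)
    · exact hhalt d hmin hd
    · exact tendsto_nhds_unique ht (hlim hne)
  · rintro rfl
    by_cases hex : ∃ k, ∑ i, x k i = 1
    · classical
      have hmin := fun e (he : e < Nat.find hex) => Nat.find_min hex he
      exact Or.inl ⟨_, Nat.find_spec hex, hmin, (hhalt _ hmin (Nat.find_spec hex)).symm⟩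
    · exact Or.inr ⟨not_exists.1 hex, hlim (not_exists.1 hex)⟩

/-- The successive intervals of the bisection for the solutions `g γ`. -/
def bisectionInterval (A : Matrix (Fin J) I ℝ) (q : I → ℝ) (g : ℝ → I → ℝ) : ℕ → ℝ × ℝ
  | 0 => (gammaLeft A q, gammaRight A q)
  | k + 1 =>
    let c := bisectionInterval A q g k
    if ∑ i, g ((c.1 + c.2) / 2) i < 1 then ((c.1 + c.2) / 2, c.2) else (c.1, (c.1 + c.2) / 2)

omit [DecidableEq I] in
theorem isBisectionRun_bisectionInterval {A : Matrix (Fin J) I ℝ} {q : I → ℝ} {g : ℝ → I → ℝ}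
    (hL : 0 < gammaLeft A q) (hR : 0 < gammaRight A q)
    (hg : ∀ γ, 0 < γ → IPFOutput A q γ (g γ)) :
    IsBisectionRun A q (fun k => (bisectionInterval A q g k).1)
      (fun k => (bisectionInterval A q g k).2)
      fun k => g (((bisectionInterval A q g k).1 + (bisectionInterval A q g k).2) / 2) := by
  have hpos : ∀ k, 0 < (bisectionInterval A q g k).1 ∧ 0 < (bisectionInterval A q g k).2 := by
    intro k
    induction k with
    | zero => exact ⟨hL, hR⟩
    | succ k ih =>
      have : 0 < ((bisectionInterval A q g k).1 + (bisectionInterval A q g k).2) / 2 := by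
        linarith [ih.1, ih.2]
      simp only [bisectionInterval]
      split_ifs
      exacts [⟨this, ih.2⟩, ⟨ih.1, this⟩]
  refine ⟨rfl, rfl, fun k _ => hg _ (by linarith [(hpos k).1, (hpos k).2]), fun k _ => ?_,
    fun k _ => ?_⟩ <;>
  · simp only [bisectionInterval]
    split_ifs <;> rfl

theorem bisectionOutput_iff (hS : ∀ j, (S j).Nonempty) (hcov : ∀ i, ∃ j, i ∈ S j)
    {ε : I → ℝ} {γ' : ℝ} (hε : LogLinear (modelMatrix S) ε) (hsum : ∑ i, ε i = 1)
    (h' : modelMatrix S *ᵥ ε = γ' • modelMatrix S *ᵥ q) (hγ' : 0 < γ')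
    (hq : modelMatrix S *ᵥ q ≠ 0) (δ : I → ℝ) :
    BisectionOutput (modelMatrix S) q δ ↔ δ = ε := by
  constructor
  · rintro ⟨γL, γR, x, hrun, hout⟩
    exact (hrun.iterationOutput_iff hS hcov hε hsum h' hγ' hq δ).1 hout
  · intro hδ
    have hex : ∀ γ, ∃ δ, 0 < γ → IPFOutput (modelMatrix S) q γ δ := by
      intro γ
      by_cases hγ : 0 < γ
      · obtain ⟨δ, hδ, h⟩ := hε.exists_of_factor hS h' hγ' hγ
        exact ⟨δ, fun _ => (ipfOutput_iff hS hδ h δ).2 rfl⟩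
      -- A dummy value: all midpoints are positive.
      · exact ⟨0, fun h => absurd h hγ⟩
    choose g hg using hex
    have hrun := isBisectionRun_bisectionInterval (gammaLeft_le hcov hε.1 hsum h' hγ').1
      (hγ'.trans_le (le_gammaRight hS hε.1 hsum h' hγ')) hg
    exact ⟨_, _, _, hrun, (hrun.iterationOutput_iff hS hcov hε hsum h' hγ' hq δ).2 hδ⟩

end

end RelationalModel

end

/-- If the maximum likelihood estimate under the relational model generated by the non-empty
subsets `S 0, …, S (J - 1)` exists and is unique, then G-IPF has exactly one output, and this
output is the maximum likelihood estimate. -/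
theorem mainTheorem1 {I : Type*} [Fintype I] [DecidableEq I] (J : ℕ) [NeZero J]
    (S : Fin J → Finset I) (hS : ∀ j, (S j).Nonempty)
    (s : RelationalModel.Sampling) (y : I → ℕ)
    (hy : s = RelationalModel.Sampling.multinomial → 0 < ∑ i, y i)
    (hMLE : ∃! δ : I → ℝ, RelationalModel.IsMLE s (RelationalModel.modelMatrix S) y δ) :
    ∃ δhat : I → ℝ,
      RelationalModel.IsMLE s (RelationalModel.modelMatrix S) y δhat ∧
      ∀ δ : I → ℝ,
        RelationalModel.GIPFOutput s (RelationalModel.modelMatrix S)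
          (RelationalModel.observed s y) δ ↔ δ = δhat := by
  open RelationalModel in
  obtain ⟨ε, hε, -⟩ := hMLE
  refine ⟨ε, hε, fun δ => ?_⟩
  cases s with
  | poisson =>
    exact ipfOutput_iff hS (⟨hε.1.1, hε.1.2⟩ : LogLinear _ _)
      (hε.mulVec_eq_of_poisson.trans (one_smul ℝ _).symm) δ
  | multinomial =>
    obtain ⟨γ, hγ, h⟩ := hε.exists_mulVec_eq_smul hS (hy rfl)
    have hcov := exists_mem_of_mem_relationalModel hS hε.1
    have hlog : LogLinear (modelMatrix S) ε := ⟨hε.1.1.1, hε.1.2⟩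
    have hsum := hε.1.1.2
    have hq : modelMatrix S *ᵥ observed .multinomial y ≠ 0 := by
      intro h0
      have := modelMatrix_mulVec_pos hS hlog.1 0
      simp [h, h0] at this
    obtain ⟨p, hp, hAp⟩ := hlog.exists_of_factor hS h hγ one_pos
    have hbis := bisectionOutput_iff hS hcov hlog hsum h hγ hq δ
    have hipf := ipfOutput_iff hS hp hAp
    simp only [GIPFOutput, hipf, exists_eq_left, hbis]
    by_cases h1 : ∑ i, p i = 1
    -- Strict monotonicity of the total forces the factors 1 and `γ` to agree, so stopping after
    -- IPF(1) is correct.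
    · have hpe : p = ε := hp.eq_of_sum_eq hq hlog hAp h one_pos hγ (h1.trans hsum.symm)
      simp [hpe, hsum]
    · simp [h1]
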